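/- Let $R=\mathbb{Z}[u,v,w,x,y,z]$, let $\Delta_1=vz-wy$, $\Delta_2=wx-uz$, $\Delta_3=uy-vx$ be the size two minors of the generic matrix $\begin{pmatrix}u&v&w\\x&y&z\end{pmatrix}$, and let $\mathfrak a=(\Delta_1,\Delta_2,\Delta_3)R$. Note that $u\Delta_1+v\Delta_2+w\Delta_3=0$. Local cohomology with support in $\mathfrak a$ is computed as the direct limit over $k$ of the Koszul cohomology of $\Delta_1^k,\Delta_2^k,\Delta_3^k$. Thus $$H^3_{\mathfrak a}(R)=\varinjlim_k R/(\Delta_1^k,\Delta_2^k,\Delta_3^k)R,$$ where the maps are induced by multiplication by $\Delta_1\Delta_2\Delta_3$. For an $R$-module $M$, $H^2_{\mathfrak a}(M)$ is the direct limit over $k$ of the modules of relations $\{(a_1,a_2,a_3)\in M^3:\ \sum_i\Delta_i^k a_i=0\}$ modulo the trivial (Koszul) relations, where the maps are induced by $(a_1,a_2,a_3)\mapsto(\Delta_2\Delta_3a_1,\Delta_3\Delta_1a_2,\Delta_1\Delta_2a_3)$. For a prime $p$ and $q=p^e$ with $e\ge 0$, the polynomial $(u\Delta_1)^q+(v\Delta_2)^q+(w\Delta_3)^q$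 is divisible by $p$ in $R$. Put $$\lambda_q=\frac{(u\Delta_1)^q+(v\Delta_2)^q+(w\Delta_3)^q}{p}\in R,\qquad \eta_q=[\lambda_q+(\Delta_1^q,\Delta_2^q,\Delta_3^q)R]\in H^3_{\mathfrak a}(R),$$ and let $\mu_q\in H^2_{\mathfrak a}(R/pR)$ be the class of the relation $(\overline u^q,\overline v^q,\overline w^q)$ on $\overline\Delta_1^q,\overline\Delta_2^q,\overline\Delta_3^q$ in $R/pR$. Hochster conjectured that for every prime $p$ there is $q=p^e$ with $e\ge1$ such that $\mu_q\notin\operatorname{Image}\big(H^2_{\mathfrak a}(R)\to H^2_{\mathfrak a}(R/pR)\big)$; in an equivalent form, that for every prime $p$ there is $q=p^e$ with $e\ge1$ such that $\eta_q$ is a nonzero $p$-torsion element of $H^3_{\mathfrak a}(R)$. Theorem. For every prime $p$ and every $q=p^e$ with $e\ge 0$, with $k=q-1$: 1. $\lambda_q(\Delta_1\Delta_2\Delta_3)^k\in(\Delta_1^{q+k},\Delta_2^{q+k},\Delta_3^{q+k})R$; 2. $\eta_q=0$ in $H^3_{\mathfrak a}(R)$; 3. $\mu_q\in\operatorname{Image}\big(H^2_{\mathfrak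 a}(R)\to H^2_{\mathfrak a}(R/pR)\big)$. Consequently Hochster's conjecture, in each of the two forms above, is false. -/

import Mathlib

namespace HochsterTorsion

noncomputable section

/-! ### Local cohomology of a module with support in an ideal `(f 0, f 1, f 2)`,
as the direct limit of the Koszul cohomology of the powers `f 0 ^ k, f 1 ^ k, f 2 ^ k` -/

section LocalCohomology

variable {R : Type*} [CommRing R] (f : Fin 3 → R)

/-- The ideal `(f 0 ^ k, f 1 ^ k, f 2 ^ k)`. -/
def powIdeal (k : ℕ) : Ideal R :=
  Ideal.span {f 0 ^ k, f 1 ^ k, f 2 ^ k}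

lemma mul_mem_powIdeal {i j : ℕ} (h : i ≤ j) {r : R} (hr : r ∈ powIdeal f i) :
    (f 0 * f 1 * f 2) ^ (j - i) * r ∈ powIdeal f j := by
  obtain ⟨m, rfl⟩ := Nat.exists_eq_add_of_le h
  simp only [powIdeal, Ideal.mem_span_insert, Ideal.mem_span_singleton'] at hr ⊢
  obtain ⟨a, _, ⟨b, _, ⟨c, rfl⟩, rfl⟩, rfl⟩ := hr
  refine ⟨a * (f 1 * f 2) ^ m, _, ⟨b * (f 0 * f 2) ^ m, _, ⟨c * (f 0 * f 1) ^ m, rfl⟩, rfl⟩, ?_⟩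
  rw [Nat.add_sub_cancel_left]
  ring

/-- The transition map `R / (f 0 ^ i, f 1 ^ i, f 2 ^ i) → R / (f 0 ^ j, f 1 ^ j, f 2 ^ j)`, for
`i ≤ j`: multiplication by `(f 0 * f 1 * f 2) ^ (j - i)`. -/
def H3trans (i j : ℕ) (h : i ≤ j) : (R ⧸ powIdeal f i) →ₗ[R] (R ⧸ powIdeal f j) :=
  Submodule.mapQ (powIdeal f i) (powIdeal f j)
    (LinearMap.mulLeft R ((f 0 * f 1 * f 2) ^ (j - i)))
    (show powIdeal f i ≤ Submodule.comap (LinearMap.mulLeft R _) (powIdeal f j) from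
      fun _ hr => mul_mem_powIdeal f h hr)

instance H3directed :
    DirectedSystem (fun k => R ⧸ powIdeal f k) (fun i j h => H3trans f i j h) where
  map_self i x := by
    obtain ⟨r, rfl⟩ := Submodule.Quotient.mk_surjective _ x
    simp [H3trans]
  map_map l j i hij hjl x := by
    obtain ⟨r, rfl⟩ := Submodule.Quotient.mk_surjective _ x
    obtain ⟨m, rfl⟩ := Nat.exists_eq_add_of_le hij
    obtain ⟨n, rfl⟩ := Nat.exists_eq_add_of_le hjl
    have e : i + m + n - i = m + n := by omega
    simp only [H3trans, Submodule.mapQ_apply, LinearMap.mulLeft_apply, Nat.add_sub_cancel_left, e]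
    congr 1
    ring

/-- The third local cohomology module of `R` with support in `(f 0, f 1, f 2)`: the direct limit
of the modules `R / (f 0 ^ k, f 1 ^ k, f 2 ^ k)` under multiplication by `f 0 * f 1 * f 2`. -/
abbrev H3 : Type _ :=
  Module.DirectLimit (fun k => R ⧸ powIdeal f k) (H3trans f)

/-- The class `[r + (f 0 ^ k, f 1 ^ k, f 2 ^ k)]` in the third local cohomology module. -/
def H3class (k : ℕ) (r : R) : H3 f :=
  Module.DirectLimit.of R ℕ (fun k => R ⧸ powIdeal f k) (H3trans f) k (Ideal.Quotient.mk _ r)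

variable (M : Type*) [AddCommGroup M] [Module R M]

/-- The last differential `a ↦ ∑ i, f i ^ k • a i` of the Koszul complex of
`f 0 ^ k, f 1 ^ k, f 2 ^ k` on `M`. -/
def koszulD2 (k : ℕ) : (Fin 3 → M) →ₗ[R] M :=
  ∑ i, f i ^ k • LinearMap.proj i

/-- The middle differential of the Koszul complex of `f 0 ^ k, f 1 ^ k, f 2 ^ k` on `M`; its
range is the module of trivial relations on these three elements. -/
def koszulD1 (k : ℕ) : (Fin 3 → M) →ₗ[R] (Fin 3 → M) where
  toFun c := ![f 2 ^ k • c 1 - f 1 ^ k • c 2, f 0 ^ k • c 2 - f 2 ^ k • c 0,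
    f 1 ^ k • c 0 - f 0 ^ k • c 1]
  map_add' c d := by
    ext i; fin_cases i <;> simp [smul_add] <;> abel
  map_smul' r c := by
    ext i; fin_cases i <;> simp [smul_sub, smul_comm r]

/-- The module of relations `∑ i, f i ^ k • a i = 0` with `a i` in `M`. -/
abbrev koszulZ (k : ℕ) : Submodule R (Fin 3 → M) :=
  LinearMap.ker (koszulD2 f M k)

/-- The second Koszul cohomology of `f 0 ^ k, f 1 ^ k, f 2 ^ k` on `M`: relations modulo trivial
relations. -/
abbrev koszulH2 (k : ℕ) : Type _ :=
  koszulZ f M k ⧸ (LinearMap.range (koszulD1 f M k)).submoduleOf (koszulZ f M k)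

lemma koszulD2_apply (k : ℕ) (a : Fin 3 → M) :
    koszulD2 f M k a = f 0 ^ k • a 0 + f 1 ^ k • a 1 + f 2 ^ k • a 2 := by
  simp [koszulD2, Fin.sum_univ_three]

/-- The trivial relations are relations. -/
lemma koszulD2_koszulD1 (k : ℕ) (c : Fin 3 → M) : koszulD2 f M k (koszulD1 f M k c) = 0 := by
  rw [koszulD2_apply]
  simp only [koszulD1, LinearMap.coe_mk, AddHom.coe_mk, Matrix.cons_val]
  module

/-- The map `(a 0, a 1, a 2) ↦ ((f 1 f 2) ^ m a 0, (f 2 f 0) ^ m a 1, (f 0 f 1) ^ m a 2)`. -/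
def shift (m : ℕ) : (Fin 3 → M) →ₗ[R] (Fin 3 → M) where
  toFun a := ![(f 1 * f 2) ^ m • a 0, (f 2 * f 0) ^ m • a 1, (f 0 * f 1) ^ m • a 2]
  map_add' c d := by
    ext i; fin_cases i <;> simp [smul_add]
  map_smul' r c := by
    ext i; fin_cases i <;> simp [smul_comm r]

lemma shift_mem {i j : ℕ} (h : i ≤ j) {a : Fin 3 → M} (ha : a ∈ koszulZ f M i) :
    shift f M (j - i) a ∈ koszulZ f M j := by
  obtain ⟨m, rfl⟩ := Nat.exists_eq_add_of_le h
  rw [LinearMap.mem_ker, koszulD2_apply] at ha ⊢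
  rw [Nat.add_sub_cancel_left]
  have := congrArg (fun t => (f 0 * f 1 * f 2) ^ m • t) ha
  simp only [smul_zero] at this
  rw [← this]
  simp only [shift, LinearMap.coe_mk, AddHom.coe_mk, Matrix.cons_val]
  module

lemma shift_koszulD1 {i j : ℕ} (h : i ≤ j) (c : Fin 3 → M) :
    shift f M (j - i) (koszulD1 f M i c) = koszulD1 f M j (fun l => f l ^ (j - i) • c l) := by
  obtain ⟨m, rfl⟩ := Nat.exists_eq_add_of_le h
  rw [Nat.add_sub_cancel_left]
  simp only [shift, koszulD1, LinearMap.coe_mk, AddHom.coe_mk]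
  ext l
  fin_cases l <;> simp only [Fin.zero_eta, Fin.mk_one, Fin.reduceFinMk, Matrix.cons_val] <;> module

/-- The transition maps between the second Koszul cohomology modules. -/
def H2trans (i j : ℕ) (h : i ≤ j) : koszulH2 f M i →ₗ[R] koszulH2 f M j :=
  Submodule.mapQ _ _
    ((shift f M (j - i)).restrict (fun _ ha => shift_mem f M h ha))
    (by
      rintro ⟨a, ha⟩ ⟨c, hc⟩
      exact ⟨_, (shift_koszulD1 f M h c).symm.trans (congrArg (shift f M (j - i)) hc)⟩)

instance H2directed :
    DirectedSystem (fun k => koszulH2 f M k) (fun i j h => H2trans f M i j h) where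
  map_self i x := by
    obtain ⟨⟨a, ha⟩, rfl⟩ := Submodule.Quotient.mk_surjective _ x
    simp only [H2trans, Submodule.mapQ_apply]
    congr 1
    ext l
    fin_cases l <;> simp [shift]
  map_map l j i hij hjl x := by
    obtain ⟨⟨a, ha⟩, rfl⟩ := Submodule.Quotient.mk_surjective _ x
    obtain ⟨m, rfl⟩ := Nat.exists_eq_add_of_le hij
    obtain ⟨n, rfl⟩ := Nat.exists_eq_add_of_le hjl
    have e : i + m + n - i = m + n := by omega
    simp only [H2trans, Submodule.mapQ_apply]
    congr 1
    ext l
    simp only [LinearMap.coe_restrict_apply, Nat.add_sub_cancel_left, e]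
    fin_cases l <;>
      simp only [shift, LinearMap.coe_mk, AddHom.coe_mk, Fin.zero_eta, Fin.mk_one,
        Fin.reduceFinMk, Matrix.cons_val] <;> module

/-- The second local cohomology module of `M` with support in `(f 0, f 1, f 2)`. -/
abbrev H2 : Type _ :=
  Module.DirectLimit (fun k => koszulH2 f M k) (H2trans f M)

/-- The class in the second local cohomology module of `M` of a relation
`∑ i, f i ^ k • a i = 0`. -/
def H2class (k : ℕ) (a : koszulZ f M k) : H2 f M :=
  Module.DirectLimit.of R ℕ (fun k => koszulH2 f M k) (H2trans f M) k (Submodule.Quotient.mk a)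

variable {M} {N : Type*} [AddCommGroup N] [Module R N] (φ : M →ₗ[R] N)

lemma koszulD2_map (k : ℕ) {a : Fin 3 → M} (ha : a ∈ koszulZ f M k) :
    φ.compLeft (Fin 3) a ∈ koszulZ f N k := by
  rw [LinearMap.mem_ker, koszulD2_apply] at ha ⊢
  simpa using congrArg φ ha

/-- The map on second Koszul cohomology induced by a linear map. -/
def koszulH2map (k : ℕ) : koszulH2 f M k →ₗ[R] koszulH2 f N k :=
  Submodule.mapQ _ _
    ((φ.compLeft (Fin 3)).restrict (fun _ ha => koszulD2_map f φ k ha))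
    (by
      rintro ⟨a, ha⟩ ⟨c, hc⟩
      refine ⟨φ.compLeft (Fin 3) c, ?_⟩
      refine Eq.trans ?_ (congrArg (φ.compLeft (Fin 3)) hc)
      ext l
      fin_cases l <;> simp [koszulD1])

/-- The map `H²(M) → H²(N)` on local cohomology induced by a linear map `M → N`. -/
def H2map : H2 f M →ₗ[R] H2 f N :=
  Module.DirectLimit.map (fun k => koszulH2map f φ k) (by
    intro i j h
    refine LinearMap.ext fun x => ?_
    obtain ⟨⟨a, ha⟩, rfl⟩ := Submodule.Quotient.mk_surjective _ x
    simp only [LinearMap.comp_apply, koszulH2map, H2trans, Submodule.mapQ_apply]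
    congr 1
    ext l
    fin_cases l <;> simp [shift])

end LocalCohomology

/-! ### The generic `2 × 3` matrix -/

/-- The polynomial ring `ℤ[u, v, w, x, y, z]`. -/
abbrev R : Type := MvPolynomial (Fin 6) ℤ

/-- The generic matrix with rows `(u, v, w)` and `(x, y, z)`. -/
def genMat : Matrix (Fin 2) (Fin 3) R :=
  !![MvPolynomial.X 0, MvPolynomial.X 1, MvPolynomial.X 2;
     MvPolynomial.X 3, MvPolynomial.X 4, MvPolynomial.X 5]

/-- The size two minors `Δ₁ = v z - w y`, `Δ₂ = w x - u z`, `Δ₃ = u y - v x` of the generic matrix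
(indexed from `0`). -/
def Δ : Fin 3 → R :=
  ![genMat 0 1 * genMat 1 2 - genMat 0 2 * genMat 1 1,
    genMat 0 2 * genMat 1 0 - genMat 0 0 * genMat 1 2,
    genMat 0 0 * genMat 1 1 - genMat 0 1 * genMat 1 0]

/-- `(u Δ₁) ^ q + (v Δ₂) ^ q + (w Δ₃) ^ q`. -/
def powSum (q : ℕ) : R :=
  (genMat 0 0 * Δ 0) ^ q + (genMat 0 1 * Δ 1) ^ q + (genMat 0 2 * Δ 2) ^ q

/-- `u Δ₁ + v Δ₂ + w Δ₃ = 0`. -/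
lemma powSum_one : powSum 1 = 0 := by
  simp only [powSum, Δ, Matrix.cons_val, pow_one]
  ring

lemma dvd_powSum {p : ℕ} (hp : p.Prime) (e : ℕ) : (p : R) ∣ powSum (p ^ e) := by
  have := Fact.mk hp
  have h := congrArg (MvPolynomial.map (σ := Fin 6) (Int.castRingHom (ZMod p))) powSum_one
  have key : ((p : ℤ) : R) = MvPolynomial.C (p : ℤ) := (eq_intCast MvPolynomial.C (p : ℤ)).symm
  rw [← Int.cast_natCast (R := R), key, MvPolynomial.C_dvd_iff_zmod]
  simp only [powSum, map_add, map_pow, pow_one, map_zero] at h ⊢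
  rw [← add_pow_char_pow, ← add_pow_char_pow, h, zero_pow (pow_ne_zero _ hp.ne_zero)]

/-- `λ_q = ((u Δ₁) ^ q + (v Δ₂) ^ q + (w Δ₃) ^ q) / p` for `q = p ^ e`. -/
def lam {p : ℕ} (hp : p.Prime) (e : ℕ) : R :=
  (dvd_powSum hp e).choose

lemma mul_lam {p : ℕ} (hp : p.Prime) (e : ℕ) : (p : R) * lam hp e = powSum (p ^ e) :=
  (dvd_powSum hp e).choose_spec.symm

/-- `λ_q` is the only polynomial with `p λ_q = (u Δ₁) ^ q + (v Δ₂) ^ q + (w Δ₃) ^ q`. -/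
lemma eq_lam {p : ℕ} (hp : p.Prime) (e : ℕ) {r : R} (hr : (p : R) * r = powSum (p ^ e)) :
    r = lam hp e :=
  mul_left_cancel₀ (Nat.cast_ne_zero.mpr hp.ne_zero) (hr.trans (mul_lam hp e).symm)

/-- `η_q = [λ_q + (Δ₁ ^ q, Δ₂ ^ q, Δ₃ ^ q)]`, for `q = p ^ e`. -/
def eta {p : ℕ} (hp : p.Prime) (e : ℕ) : H3 Δ :=
  H3class Δ (p ^ e) (lam hp e)

/-- The module `R / p R`. -/
abbrev Rmod (p : ℕ) : Type := R ⧸ Ideal.span {(p : R)}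

/-- The canonical projection `R → R / p R`. -/
def red (p : ℕ) : R →ₗ[R] Rmod p := Submodule.mkQ (Ideal.span {(p : R)})

lemma rel_mem {p : ℕ} (hp : p.Prime) (e : ℕ) :
    (fun i => red p (genMat 0 i ^ p ^ e)) ∈ koszulZ Δ (Rmod p) (p ^ e) := by
  rw [LinearMap.mem_ker, koszulD2_apply]
  simp only [← map_smul, ← map_add, smul_eq_mul, ← mul_pow]
  refine (Submodule.Quotient.mk_eq_zero _).mpr (Ideal.mem_span_singleton.mpr ?_)
  simpa only [powSum, mul_comm] using dvd_powSum hp e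

/-- `μ_q`, for `q = p ^ e`: the class of the relation `(u ^ q, v ^ q, w ^ q)` on the elements
`Δ₁ ^ q, Δ₂ ^ q, Δ₃ ^ q` modulo `p`. -/
def mu {p : ℕ} (hp : p.Prime) (e : ℕ) : H2 Δ (Rmod p) :=
  H2class Δ (Rmod p) (p ^ e) ⟨fun i => red p (genMat 0 i ^ p ^ e), rel_mem hp e⟩

/-- Hochster's conjecture: for every prime `p` there is `q = p ^ e` such that `μ_q` is not in the
image of `H²(R) → H²(R / p R)`. -/
def HochsterConjecture : Prop :=
  ∀ (p : ℕ) (hp : p.Prime), ∃ e : ℕ, 0 < e ∧ mu hp e ∉ LinearMap.range (H2map Δ (red p))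

/-- The equivalent form of Hochster's conjecture: for every prime `p` there is `q = p ^ e` such that
`η_q` is a nonzero `p`-torsion element of `H³(R)`. -/
def HochsterConjectureTorsion : Prop :=
  ∀ (p : ℕ) (hp : p.Prime), ∃ e : ℕ, 0 < e ∧ eta hp e ≠ 0 ∧ (p : R) • eta hp e = 0

end

end HochsterTorsion

namespace HochsterTorsion

noncomputable section

/-! ### Binomial coefficients modulo a prime -/

/-! Put `k = q - 1` and `D = Δ₁Δ₂Δ₃`. The proof applies the residue theorem on the projective line
to `F dX / (X ^ (k+1) (1 - X) ^ (k+1))`, where `F = (a + bX) ^ (2k+1) (a' + b'X) ^ k`, `a = uΔ₁`, `b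
= vΔ₂`, `a' = xΔ₁`, `b' = yΔ₂`. Since `F` has degree at most `3k+1`, the poles at `0`, `1`, `∞` all
have order at most `k+1`. Since both rows of the matrix are orthogonal to the minors, the two linear
forms take at `0`, `∞`, `1` the values `uΔ₁, vΔ₂, -wΔ₃` and `xΔ₁, yΔ₂, -zΔ₃`, so the three points
play the same role.

Each residue is divisible by the power `2k+1` of the minor attached to its point. Modulo `p` times
that power it equals, up to sign, `(uΔ₁) ^ q D ^ k` or its analogue, because of congruences for
binomial coefficients (`residue_binForm_eq`). The vanishing of the sum of residues
(`residue_binForm_relation`) thus reads `p λ_q D ^ k = p ∑ bᵢ Δᵢ ^ (2k+1)`, and `p` cancels. This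
gives `η_q = 0`, and the `bᵢ` correct the relation modulo `p` to one over `ℤ`, which lifts `μ_q`. -/

lemma dvd_of_pow_dvd_mul {p e m c : ℕ} (hp : p.Prime) (hm : m ≠ 0) (hlt : m < p ^ e)
    (h : p ^ e ∣ m * c) : p ∣ c := by
  by_contra hc
  have hco : Nat.Coprime (p ^ e) c := Nat.Coprime.pow_left e ((hp.coprime_iff_not_dvd).2 hc)
  exact absurd (Nat.le_of_dvd (Nat.pos_of_ne_zero hm) (hco.dvd_of_dvd_mul_right h)) (by omega)

/-- With `n = 2k - j`, the identity `(k+1) C(n, k+1) = (n-k) C(n, k)` has `k + 1 = q` on the left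
and `0 < n - k < q` on the right. -/
lemma dvd_choose_two_mul_sub {p e k j : ℕ} (hp : p.Prime) (hk : k + 1 = p ^ e) (hj : j < k) :
    p ∣ (2 * k - j).choose k := by
  refine dvd_of_pow_dvd_mul (e := e) (m := k - j) hp (by omega) (by omega) ?_
  have h := Nat.choose_succ_right_eq (2 * k - j) k
  rw [show 2 * k - j - k = k - j by omega, hk] at h
  exact ⟨_, (mul_comm _ _).trans (h.symm.trans (mul_comm _ _))⟩

/-- `p` divides `C(2q, l+1)` for `l + 1 < q`, so by Pascal's rule consecutive entries of row `2q -
1` are opposite modulo `p`. -/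
lemma dvd_choose_sub_neg_one_pow {p e k l : ℕ} (hp : p.Prime) (hk : k + 1 = p ^ e) (hl : l ≤ k) :
    (p : ℤ) ∣ (2 * k + 1).choose l - (-1) ^ l := by
  induction l with
  | zero => simp
  | succ l ih =>
    have h1 : p ∣ (2 * k + 2).choose (l + 1) := by
      refine dvd_of_pow_dvd_mul (e := e) (m := l + 1) hp (by omega) (by omega) ?_
      have h := Nat.add_one_mul_choose_eq (2 * k + 1) l
      refine ⟨2 * (2 * k + 1).choose l, ?_⟩
      rw [← hk]
      linarith
    rw [Nat.choose_succ_succ'] at h1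
    have h2 : (p : ℤ) ∣ (2 * k + 1).choose l + (2 * k + 1).choose (l + 1) := by exact_mod_cast h1
    have h3 := dvd_sub h2 (ih (by omega))
    have h4 (x y s : ℤ) : x + y - (x - s) = y - s * -1 := by ring
    rwa [h4, ← pow_succ] at h3

/-! ### The residue theorem for poles at `0`, `1`, `∞`, and residues modulo `p` -/

section Residue

open Polynomial

variable {S : Type*} [CommRing S]

/-- The residue at `0` of `N / (X ^ (k + 1) * (1 - X) ^ (k + 1))`. -/
def residue (S : Type*) [CommRing S] (k : ℕ) : S[X] →ₗ[S] S :=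
  ∑ j ∈ Finset.range (k + 1), ((2 * k - j).choose k : S) • lcoeff S j

lemma residue_apply (k : ℕ) (N : S[X]) :
    residue S k N = ∑ j ∈ Finset.range (k + 1), ((2 * k - j).choose k : S) * N.coeff j := by
  simp [residue]

lemma residue_eq_coeff (k : ℕ) (N : S[X]) :
    residue S k N =
      PowerSeries.coeff k ((N : PowerSeries S) * (PowerSeries.invOneSubPow S (k + 1)).val) := by
  rw [residue_apply, PowerSeries.coeff_mul, Finset.Nat.sum_antidiagonal_eq_sum_range_succ_mk]
  refine Finset.sum_congr rfl fun j hj => ?_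
  have hj := Finset.mem_range.1 hj
  simp only [coeff_coe, PowerSeries.invOneSubPow_val_succ_eq_mk_add_choose, PowerSeries.coeff_mk]
  rw [mul_comm, show k + (k - j) = 2 * k - j by omega]

lemma residue_X_pow_of_le {k m : ℕ} (hm : m ≤ k) :
    residue S k (X ^ m) = ((2 * k - m).choose k : S) := by
  rw [residue_apply, Finset.sum_eq_single m]
  · simp
  · intro j _ hj; simp [coeff_X_pow, hj]
  · intro h; exact absurd (Finset.mem_range.2 (by omega)) h

lemma residue_X_pow_of_lt {k m : ℕ} (hm : k < m) : residue S k (X ^ m) = 0 := by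
  rw [residue_apply, Finset.sum_eq_zero]
  intro j hj
  have := Finset.mem_range.1 hj
  rw [coeff_X_pow, if_neg (by omega), mul_zero]

lemma coeff_one_sub_X_pow (n k : ℕ) :
    ((1 - X : S[X]) ^ n).coeff k = (-1) ^ k * (n.choose k : S) := by
  have h : (1 - X : S[X]) ^ n = ((1 + X) ^ n).comp (C (-1) * X) := by simp [sub_eq_add_neg]
  rw [h, comp_C_mul_X_coeff, coeff_one_add_X_pow, mul_comm]

lemma residue_one_sub_X_pow_of_le {k m : ℕ} (hm : m ≤ k) :
    residue S k ((1 - X) ^ m) = ((2 * k - m).choose k : S) := by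
  obtain ⟨d, rfl⟩ := Nat.exists_eq_add_of_le hm
  have h := PowerSeries.one_sub_pow_mul_invOneSubPow_val_add_eq_invOneSubPow_val S (d + 1) m
  rw [residue_eq_coeff, show m + d + 1 = d + 1 + m by omega]
  simp only [coe_pow, coe_sub, coe_one, coe_X, h,
    PowerSeries.invOneSubPow_val_succ_eq_mk_add_choose, PowerSeries.coeff_mk]
  rw [show 2 * (m + d) - m = d + (m + d) by omega, Nat.choose_symm_add]

lemma residue_one_sub_X_pow_of_lt {k m : ℕ} (hm : k < m) :
    residue S k ((1 - X) ^ m) = (-1) ^ k * ((m - (k + 1)).choose k : S) := by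
  obtain ⟨d, rfl⟩ := Nat.exists_eq_add_of_lt hm
  have h := PowerSeries.one_sub_pow_add_mul_invOneSubPow_val_eq_one_sub_pow S d (k + 1)
  rw [residue_eq_coeff, show k + d + 1 = d + (k + 1) by omega]
  simp only [coe_pow, coe_sub, coe_one, coe_X, h]
  rw [Nat.add_sub_cancel, ← coeff_one_sub_X_pow, ← coeff_coe]
  simp

/-- The sum of the residues of `N / (X ^ (k + 1) * (1 - X) ^ (k + 1))` at `0`, `1` and `∞` is
zero. -/
lemma residue_add_residue_reflect (k : ℕ) {N : S[X]} (hN : N.natDegree ≤ 3 * k + 1) :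
    residue S k N + (-1) ^ k * residue S k (reflect (3 * k + 1) N) =
      residue S k (N.comp (1 - X)) := by
  rw [N.as_sum_range' (3 * k + 2) (by omega)]
  have hr (s : Finset ℕ) (f : ℕ → S[X]) : reflect (3 * k + 1) (∑ i ∈ s, f i) =
      ∑ i ∈ s, reflect (3 * k + 1) (f i) := by
    classical
    induction s using Finset.induction_on with
    | empty => simp
    | insert a s ha ih => rw [Finset.sum_insert ha, Finset.sum_insert ha, reflect_add, ih]
  rw [hr, sum_comp, map_sum, map_sum, map_sum, Finset.mul_sum, ← Finset.sum_add_distrib]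
  refine Finset.sum_congr rfl fun m hm => ?_
  have hm := Finset.mem_range.1 hm
  rw [← C_mul_X_pow_eq_monomial, reflect_C_mul_X_pow, revAt_le (by omega), mul_comp, C_comp,
    pow_comp, X_comp, ← smul_eq_C_mul, ← smul_eq_C_mul, ← smul_eq_C_mul, map_smul, map_smul,
    map_smul]
  simp only [smul_eq_mul]
  rw [← mul_left_comm, ← mul_add]
  congr 1
  -- By linearity `N = X ^ m`. There is a pole at `0` only for `m ≤ k` and at `∞` only for `m > 2k`;
  -- in between, the binomial coefficient giving the residue at `1` vanishes.
  rcases Nat.lt_or_ge k m with h | h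
  · rw [residue_X_pow_of_lt h, residue_one_sub_X_pow_of_lt h, zero_add]
    congr 1
    rcases Nat.lt_or_ge (2 * k) m with h' | h'
    · rw [residue_X_pow_of_le (by omega)]
      congr 2
      omega
    · rw [residue_X_pow_of_lt (by omega), Nat.choose_eq_zero_of_lt (by omega), Nat.cast_zero]
  · rw [residue_X_pow_of_le h, residue_one_sub_X_pow_of_le h, residue_X_pow_of_lt (by omega),
      mul_zero, add_zero]

lemma natDegree_linear_pow_le (a b : S) (n : ℕ) : ((C a + C b * X) ^ n).natDegree ≤ n := by
  refine natDegree_pow_le_of_le n (m := 1) ?_ |>.trans (by omega)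
  compute_degree

lemma reflect_linear_pow (a b : S) (n : ℕ) :
    reflect n ((C a + C b * X) ^ n) = (C b + C a * X) ^ n := by
  induction n with
  | zero => simp [reflect_one]
  | succ n ih =>
    rw [pow_succ, reflect_mul _ _ (natDegree_linear_pow_le a b n) (G := 1) (by compute_degree), ih,
      reflect_add, reflect_C_mul, reflect_one_X, reflect_C, pow_succ]
    ring

lemma coeff_linear_pow (a b : S) (n i : ℕ) :
    ((C a + C b * X) ^ n).coeff i = a ^ (n - i) * b ^ i * n.choose i := by
  rw [add_comm, add_pow, finsetSum_coeff]
  simp only [mul_pow, ← C_pow, ← C_eq_natCast]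
  rcases Nat.lt_or_ge n i with h | h
  · rw [Nat.choose_eq_zero_of_lt h, Nat.cast_zero, mul_zero, Finset.sum_eq_zero]
    intro j hj
    have := Finset.mem_range.1 hj
    rw [coeff_mul_C, coeff_mul_C, coeff_C_mul_X_pow, if_neg (by omega)]
    simp
  · rw [Finset.sum_eq_single i]
    · rw [coeff_mul_C, coeff_mul_C, coeff_C_mul_X_pow, if_pos rfl]
      ring
    · intro j _ hj
      rw [coeff_mul_C, coeff_mul_C, coeff_C_mul_X_pow, if_neg (Ne.symm hj)]
      simp
    · intro hi; exact absurd (Finset.mem_range.2 (by omega)) hi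

/-- The binary form `(a + b X) ^ (2 k + 1) * (a' + b' X) ^ k`. -/
def binForm (k : ℕ) (a b a' b' : S) : S[X] :=
  (C a + C b * X) ^ (2 * k + 1) * (C a' + C b' * X) ^ k

/-- Reflection exchanges the values `a`, `b` of a linear form at `0` and `∞`; the substitution `X ↦
1 - X` turns `a + bX` into `-(c + bX)`, moving the point `1` to `0`. -/
lemma residue_binForm_relation (k : ℕ) {a b c a' b' c' : S} (h : a + b + c = 0)
    (h' : a' + b' + c' = 0) :
    residue S k (binForm k a b a' b') + (-1) ^ k * residue S k (binForm k b a b' a') +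
      (-1) ^ k * residue S k (binForm k c b c' b') = 0 := by
  have hdeg : (binForm k a b a' b').natDegree ≤ 3 * k + 1 :=
    (natDegree_mul_le_of_le (natDegree_linear_pow_le a b _)
      (natDegree_linear_pow_le a' b' k)).trans (by omega)
  have hrefl : reflect (3 * k + 1) (binForm k a b a' b') = binForm k b a b' a' := by
    rw [show 3 * k + 1 = 2 * k + 1 + k by omega, binForm,
      reflect_mul _ _ (natDegree_linear_pow_le a b _) (natDegree_linear_pow_le a' b' k),
      reflect_linear_pow, reflect_linear_pow, binForm]
  have hcomp : (binForm k a b a' b').comp (1 - X) =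
      C ((-1) ^ (k + 1)) * binForm k c b c' b' := by
    have e (a b c : S) (h : a + b + c = 0) :
        C a + C b * (1 - X) = -(C c + C b * X : S[X]) := by
      have := congrArg C h
      simp only [map_add, map_zero] at this
      linear_combination this
    simp only [binForm, mul_comp, pow_comp, add_comp, C_comp, X_comp, e a b c h, e a' b' c' h']
    have e2 : (-1 : S[X]) ^ (2 * k + 1) = -1 := by
      rw [pow_succ, pow_mul, neg_one_sq, one_pow, one_mul]
    rw [neg_pow, neg_pow (C c' + _), e2, map_pow, map_neg, map_one, pow_succ (-1 : S[X])]
    ring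
  have := residue_add_residue_reflect k hdeg
  rw [hrefl, hcomp, ← smul_eq_C_mul, map_smul, smul_eq_mul] at this
  rw [this]
  ring

/-- In the coefficient of `X ^ j` with `j ≤ k`, every monomial has degree `3k+1-j ≥ 2k+1` in the
values at `0`, both multiples of `δ`. Modulo `p` only `j = k` survives, and there `C(2k+1, l) ≡ (-1)
^ l` reassembles the power of the determinant. -/
lemma residue_binForm_eq {p e k : ℕ} (hp : p.Prime) (hk : k + 1 = p ^ e) (δ u x b b' : S) :
    ∃ r, residue S k (binForm k (u * δ) b (x * δ) b') =
      (u * δ) ^ (k + 1) * (u * δ * b' - x * δ * b) ^ k + p * (δ ^ (2 * k + 1) * r) := by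
  suffices h : (p : S) * δ ^ (2 * k + 1) ∣ residue S k (binForm k (u * δ) b (x * δ) b') -
      (u * δ) ^ (k + 1) * (u * δ * b' - x * δ * b) ^ k by
    obtain ⟨r, hr⟩ := h
    exact ⟨r, by linear_combination hr⟩
  have hpow {n : ℕ} (y : S) {m : ℕ} (hm : n ≤ m) : δ ^ n ∣ (y * δ) ^ m :=
    (pow_dvd_pow δ hm).trans (pow_dvd_pow_of_dvd (dvd_mul_left _ _) _)
  have hmon {l t : ℕ} (hl : l ≤ 2 * k + 1) (ht : t ≤ k) (hlt : l + t ≤ k) :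
      δ ^ (2 * k + 1) ∣ (u * δ) ^ (2 * k + 1 - l) * (x * δ) ^ (k - t) := by
    refine (pow_dvd_pow δ (show 2 * k + 1 ≤ (2 * k + 1 - l) + (k - t) by omega)).trans ?_
    rw [pow_add]
    exact mul_dvd_mul (hpow u le_rfl) (hpow x le_rfl)
  rw [residue_apply, Finset.sum_range_succ, add_sub_assoc]
  refine dvd_add (Finset.dvd_sum fun j hj => ?_) ?_
  · have hj := Finset.mem_range.1 hj
    refine mul_dvd_mul (by exact_mod_cast Nat.cast_dvd_cast (dvd_choose_two_mul_sub hp hk hj)) ?_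
    rw [binForm, coeff_mul]
    refine Finset.dvd_sum fun lt hlt => ?_
    have := Finset.HasAntidiagonal.mem_antidiagonal.1 hlt
    rw [coeff_linear_pow, coeff_linear_pow]
    refine (hmon (l := lt.1) (t := lt.2) (by omega) (by omega) (by omega)).trans
      ⟨b ^ lt.1 * (2 * k + 1).choose lt.1 * (b' ^ lt.2 * k.choose lt.2), by ring⟩
  · have hbin : (u * δ * b' - x * δ * b) ^ k = ∑ lt ∈ Finset.HasAntidiagonal.antidiagonal k,
        (-(x * δ * b)) ^ lt.1 * (u * δ * b') ^ lt.2 * k.choose lt.2 := by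
      rw [sub_eq_neg_add, (Commute.all _ _).add_pow']
      refine Finset.sum_congr rfl fun lt hlt => ?_
      rw [Nat.choose_symm_of_eq_add (Finset.HasAntidiagonal.mem_antidiagonal.1 hlt).symm, nsmul_eq_mul,
        mul_comm]
    rw [binForm, coeff_mul, hbin, show 2 * k - k = k by omega, Nat.choose_self, Nat.cast_one,
      one_mul, Finset.mul_sum, ← Finset.sum_sub_distrib]
    refine Finset.dvd_sum fun ⟨l, t⟩ hlt => ?_
    have hlt : l + t = k := Finset.HasAntidiagonal.mem_antidiagonal.1 hlt
    obtain ⟨c, hc⟩ := dvd_choose_sub_neg_one_pow hp hk (show l ≤ k by omega)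
    have hc' : ((2 * k + 1).choose l : S) = (-1) ^ l + p * c := by
      have := congrArg (Int.cast : ℤ → S) hc
      push_cast at this
      linear_combination this
    obtain ⟨d, hd⟩ := hmon (l := l) (t := t) (by omega) (by omega) (by omega)
    rw [coeff_linear_pow, coeff_linear_pow]
    dsimp only
    rw [hc']
    refine ⟨d * (c * b ^ l * b' ^ t * k.choose t), ?_⟩
    subst hlt
    have e1 : 2 * (l + t) + 1 - l = (l + t + 1) + t := by omega
    have e2 : l + t - t = l := by omega
    rw [e1, e2] at hd
    rw [e1, e2, neg_pow (x * δ * b), mul_pow (x * δ), mul_pow (u * δ) b', pow_add (u * δ) (l + t + 1)]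
    rw [pow_add (u * δ) (l + t + 1)] at hd
    linear_combination (p : S) * c * b ^ l * b' ^ t * ((l + t).choose t) * hd

end Residue

/-! ### The classes `η_q` and `μ_q` -/

lemma exists_lam_mul_eq {p : ℕ} (hp : p.Prime) (e : ℕ) : ∃ b : Fin 3 → R,
    lam hp e * (Δ 0 * Δ 1 * Δ 2) ^ (p ^ e - 1) = b 0 * Δ 0 ^ (p ^ e + (p ^ e - 1)) +
      b 1 * Δ 1 ^ (p ^ e + (p ^ e - 1)) + b 2 * Δ 2 ^ (p ^ e + (p ^ e - 1)) := by
  obtain ⟨k, hk⟩ : ∃ k, k + 1 = p ^ e := ⟨p ^ e - 1, Nat.sub_add_cancel (pow_pos hp.pos e)⟩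
  have hrow (i : Fin 2) : genMat i 0 * Δ 0 + genMat i 1 * Δ 1 + genMat i 2 * Δ 2 = 0 := by
    fin_cases i <;> simp [Δ] <;> ring
  have hD01 : genMat 0 0 * Δ 0 * (genMat 1 1 * Δ 1) - genMat 1 0 * Δ 0 * (genMat 0 1 * Δ 1) =
      Δ 0 * Δ 1 * Δ 2 := by
    simp only [Δ, Matrix.cons_val]; ring
  have hD10 : genMat 0 1 * Δ 1 * (genMat 1 0 * Δ 0) - genMat 1 1 * Δ 1 * (genMat 0 0 * Δ 0) =
      -(Δ 0 * Δ 1 * Δ 2) := by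
    simp only [Δ, Matrix.cons_val]; ring
  have hD21 : genMat 0 2 * Δ 2 * (genMat 1 1 * Δ 1) - genMat 1 2 * Δ 2 * (genMat 0 1 * Δ 1) =
      -(Δ 0 * Δ 1 * Δ 2) := by
    simp only [Δ, Matrix.cons_val]; ring
  have hrel := residue_binForm_relation k (hrow 0) (hrow 1)
  obtain ⟨r₀, h₀⟩ := residue_binForm_eq hp hk (Δ 0) (genMat 0 0) (genMat 1 0)
    (genMat 0 1 * Δ 1) (genMat 1 1 * Δ 1)
  obtain ⟨r₁, h₁⟩ := residue_binForm_eq hp hk (Δ 1) (genMat 0 1) (genMat 1 1)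
    (genMat 0 0 * Δ 0) (genMat 1 0 * Δ 0)
  obtain ⟨r₂, h₂⟩ := residue_binForm_eq hp hk (Δ 2) (genMat 0 2) (genMat 1 2)
    (genMat 0 1 * Δ 1) (genMat 1 1 * Δ 1)
  rw [hD01] at h₀
  rw [hD10] at h₁
  rw [hD21] at h₂
  rw [h₀, h₁, h₂, neg_pow] at hrel
  -- The signs are those of the residue relation; on the main terms they cancel against `(-D) ^ k`
  -- from the determinants `hD10` and `hD21`.
  refine ⟨![-r₀, -(-1) ^ k * r₁, -(-1) ^ k * r₂], ?_⟩
  refine mul_left_cancel₀ (Nat.cast_ne_zero.mpr hp.ne_zero : (p : R) ≠ 0) ?_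
  have hl := mul_lam hp e
  have hs : ((-1 : R) ^ k) ^ 2 = 1 := by rw [← pow_mul, mul_comm, pow_mul, neg_one_sq, one_pow]
  rw [← hk, powSum] at hl
  rw [← hk, Nat.add_sub_cancel, show k + 1 + k = 2 * k + 1 by omega]
  simp only [Matrix.cons_val]
  linear_combination (Δ 0 * Δ 1 * Δ 2) ^ k * hl + hrel -
    ((genMat 0 1 * Δ 1) ^ (k + 1) + (genMat 0 2 * Δ 2) ^ (k + 1)) * (Δ 0 * Δ 1 * Δ 2) ^ k * hs

lemma lam_mul_mem {p : ℕ} (hp : p.Prime) (e : ℕ) :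
    lam hp e * (Δ 0 * Δ 1 * Δ 2) ^ (p ^ e - 1) ∈ powIdeal Δ (p ^ e + (p ^ e - 1)) := by
  obtain ⟨b, hb⟩ := exists_lam_mul_eq hp e
  simp only [powIdeal, Ideal.mem_span_insert, Ideal.mem_span_singleton']
  exact ⟨b 0, _, ⟨b 1, _, ⟨b 2, rfl⟩, rfl⟩, by rw [hb]; ring⟩

lemma eta_eq_zero {p : ℕ} (hp : p.Prime) (e : ℕ) : eta hp e = 0 := by
  have hle : p ^ e ≤ p ^ e + (p ^ e - 1) := Nat.le_add_right _ _
  rw [eta, H3class, ← Module.DirectLimit.of_f (hij := hle)]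
  have : H3trans Δ _ _ hle (Ideal.Quotient.mk _ (lam hp e)) = 0 := by
    refine (Submodule.Quotient.mk_eq_zero _).mpr ?_
    rw [LinearMap.mulLeft_apply, Nat.add_sub_cancel_left, mul_comm]
    exact lam_mul_mem hp e
  rw [this, map_zero]

lemma mu_mem_range {p : ℕ} (hp : p.Prime) (e : ℕ) :
    mu hp e ∈ LinearMap.range (H2map Δ (red p)) := by
  obtain ⟨b, hb⟩ := exists_lam_mul_eq hp e
  have hle : p ^ e ≤ p ^ e + (p ^ e - 1) := Nat.le_add_right _ _
  have hl := mul_lam hp e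
  rw [powSum] at hl
  set q := p ^ e
  set k := q - 1
  -- Over `ℤ` the shifted triple fails to be a relation by `p λ_q D ^ k`. Subtracting `p b` removes
  -- this defect and changes nothing modulo `p`.
  let a : Fin 3 → R := shift Δ R k (fun i => genMat 0 i ^ q) - (p : R) • b
  have ha : a ∈ koszulZ Δ R (q + k) := by
    rw [LinearMap.mem_ker, koszulD2_apply]
    simp only [a, shift, LinearMap.coe_mk, AddHom.coe_mk, Pi.sub_apply, Pi.smul_apply,
      Matrix.cons_val, smul_eq_mul]
    linear_combination (p : R) * hb - (Δ 0 * Δ 1 * Δ 2) ^ k * hl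
  refine ⟨H2class Δ R (q + k) ⟨a, ha⟩, ?_⟩
  rw [H2map, H2class, Module.DirectLimit.map_apply_of, mu, H2class,
    ← Module.DirectLimit.of_f (hij := hle)]
  congr 1
  simp only [koszulH2map, H2trans, Submodule.mapQ_apply]
  congr 1
  ext i
  have hp0 (r : R) : red p ((p : R) * r) = 0 :=
    (Submodule.Quotient.mk_eq_zero _).mpr (Ideal.mul_mem_right _ _ (Ideal.mem_span_singleton_self _))
  simp only [LinearMap.coe_restrict_apply, LinearMap.compLeft_apply, Function.comp_apply, a,
    Pi.sub_apply, Pi.smul_apply, smul_eq_mul, map_sub, hp0, sub_zero,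
    Nat.add_sub_cancel_left]
  fin_cases i <;> simp only [shift, LinearMap.coe_mk, AddHom.coe_mk, Fin.zero_eta, Fin.mk_one,
    Fin.reduceFinMk, Matrix.cons_val, map_smul] <;> rfl

end

end HochsterTorsion

theorem mainTheorem1 :
    (∀ (p : ℕ) (hp : p.Prime) (e : ℕ),
      HochsterTorsion.lam hp e *
          (HochsterTorsion.Δ 0 * HochsterTorsion.Δ 1 * HochsterTorsion.Δ 2) ^ (p ^ e - 1) ∈
        Ideal.span {HochsterTorsion.Δ 0 ^ (p ^ e + (p ^ e - 1)),
          HochsterTorsion.Δ 1 ^ (p ^ e + (p ^ e - 1)),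
          HochsterTorsion.Δ 2 ^ (p ^ e + (p ^ e - 1))} ∧
      HochsterTorsion.eta hp e = 0 ∧
      HochsterTorsion.mu hp e ∈
        LinearMap.range (HochsterTorsion.H2map HochsterTorsion.Δ (HochsterTorsion.red p))) ∧
    ¬ HochsterTorsion.HochsterConjecture ∧
    ¬ HochsterTorsion.HochsterConjectureTorsion := by
  refine ⟨fun p hp e => ⟨HochsterTorsion.lam_mul_mem hp e, HochsterTorsion.eta_eq_zero hp e,
    HochsterTorsion.mu_mem_range hp e⟩, fun h => ?_, fun h => ?_⟩
  · obtain ⟨e, _, he⟩ := h 2 Nat.prime_two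
    exact he (HochsterTorsion.mu_mem_range Nat.prime_two e)
  · obtain ⟨e, _, he, _⟩ := h 2 Nat.prime_two
    exact he (HochsterTorsion.eta_eq_zero Nat.prime_two e)
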